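/- Let $X$ be a set of indeterminates. A word $\omega$ over $X$ is an element of the free group on $X$; for a group $G$, let $G_\omega$ denote the set of all values in $G$ obtained from $\omega$ by substituting elements of $G$ for the indeterminates, and let $\omega(G)=\langle G_\omega\rangle$ be the corresponding verbal subgroup. Outer commutator words are defined recursively: every indeterminate is an outer commutator word, and if $\alpha$ and $\beta$ are outer commutator words with no indeterminate in common, then $[\alpha,\beta]=\alpha^{-1}\beta^{-1}\alpha\beta$ is an outer commutator word. **Theorem A.** Let $\omega$ be an outer commutator word and let $G$ be a group such that $G_\omega$ is finite with $|G_\omega|=m$. Then $\omega(G)$ is finite, and: (i) if $G$ is soluble, then $|\omega(G)|\le 2^{m-1}$; (ii) if $G$ is not soluble, then $|\omega(G)|\le (m-1)^{m-1}$. Consequently, outer commutator words are uniformly concise: there is a function $f\colon\mathbb{N}\to\mathbb{N}$ such that for every outer commutator word $\omega$ and every group $G$ in which $\omega$ takes exactly $m$ values, with $m$ finite, $\omega(G)$ is finite and $|\omega(G)|\le f(m)$. -/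

import Mathlib

universe u v

namespace GroupWord

/-- The set of indeterminates that appear in (the reduced form of) a word `w`, where a word over
`X` is an element of the free group on `X`. -/
noncomputable def indeterminates {X : Type u} (w : FreeGroup X) : Set X :=
  letI : DecidableEq X := Classical.decEq X
  {x | ∃ b : Bool, (x, b) ∈ w.toWord}

/-- Two words are disjoint if no indeterminate appears in both. -/
def DisjointWords {X : Type u} (a b : FreeGroup X) : Prop :=
  Disjoint (indeterminates a) (indeterminates b)

/-- Outer commutator words over `X`: the indeterminates, and the commutators
`[a, b] = a⁻¹ b⁻¹ a b` of disjoint outer commutator words `a` and `b`. -/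
inductive IsOuterCommutator {X : Type u} : FreeGroup X → Prop
  | indeterminate (x : X) : IsOuterCommutator (FreeGroup.of x)
  | commutator (a b : FreeGroup X) (ha : IsOuterCommutator a) (hb : IsOuterCommutator b)
      (hab : DisjointWords a b) : IsOuterCommutator (a⁻¹ * b⁻¹ * a * b)

/-- The set of values of the word `w` in `G`, obtained by substituting arbitrary elements of `G`
for the indeterminates. -/
def values {X : Type u} (w : FreeGroup X) (G : Type v) [Group G] : Set G :=
  Set.range fun g : X → G => FreeGroup.lift g w

/-- The verbal subgroup `w(G)`, generated by all values of `w` in `G`. -/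
def verbalSubgroup {X : Type u} (w : FreeGroup X) (G : Type v) [Group G] : Subgroup G :=
  Subgroup.closure (values w G)

end GroupWord

open Subgroup
open scoped commutatorElement

/-! ### Labelled commutator trees and their subgroups. -/

namespace GroupWord

/-! Label each leaf of the bracketing by some `n` and let its entry range over the `n`-th derived
subgroup. All labels `0` give the word itself, so values of relabelled trees are values of the word.
Modulo `upper`, where one label is raised, a power of a value of a tree is again a value of that
tree (`exists_val_eq_zpow`), and values of trees of the same shape and size commute modulo those of
greater size. Adjoin trees by decreasing size, one generator at a time: the cosets in each step are
represented by values, so `n` new values give index at most `n + 1 ≤ 2 ^ n`. Different steps count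
disjoint sets of values, so the exponents add up (`boundedOver_sub`). If `G` is soluble, some
derived subgroup is trivial, and the identity is not counted.

If `G` is not soluble, the bounded indices force the derived series to stop at a nontrivial perfect
subgroup `P` of the verbal subgroup, generated by the values of the word in `P`. If `s` of these are
nontrivial, then `|P| ≤ s ^ s` (`card_le_of_perfect`): `P` is generated by conjugacy classes with at
most `s` elements in total, one class for each maximal normal subgroup, and each element has a
central power of exponent at most `s`. Perfectness allows these central powers to be treated as
trivial, and Dicman's lemma applies. As `s ≥ 2`, the factor `2` per value outside `P` is absorbed in
the final bound. -/

/-- The shape of an outer commutator word, with natural numbers labelling the leaves. -/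
inductive CommTree : Type
  | leaf (n : ℕ) : CommTree
  | node (l r : CommTree) : CommTree

namespace CommTree

/-- The tree of the same shape with all labels equal to zero. -/
def erase : CommTree → CommTree
  | leaf _ => leaf 0
  | node l r => node (erase l) (erase r)

/-- The sum of the labels. -/
def size : CommTree → ℕ
  | leaf n => n
  | node l r => size l + size r

/-- The greatest label. -/
def maxLabel : CommTree → ℕ
  | leaf n => n
  | node l r => max (maxLabel l) (maxLabel r)

/-- The number of leaves. -/
def leaves : CommTree → ℕ
  | leaf _ => 1
  | node l r => leaves l + leaves r

/-- The length of the longest branch. -/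
def height : CommTree → ℕ
  | leaf _ => 0
  | node l r => max (height l) (height r) + 1

variable {G : Type v} [Group G] (N : ℕ → Subgroup G)

/-- The values of the commutator word of the tree, where a leaf with label `n` takes values in
`N n`. -/
def val : CommTree → Set G
  | leaf n => N n
  | node l r => {x | ∃ a ∈ val l, ∃ b ∈ val r, x = a⁻¹ * b⁻¹ * a * b}

/-- The iterated commutator subgroup of the subgroups `N n`, bracketed as in the tree. -/
def sub : CommTree → Subgroup G
  | leaf n => N n
  | node l r => ⁅sub l, sub r⁆

/-- The product of the iterated commutator subgroups in which one label is increased by one. -/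
def upper : CommTree → Subgroup G
  | leaf n => N (n + 1)
  | node l r => ⁅upper l, sub N r⁆ ⊔ ⁅sub N l, upper r⁆

theorem size_le (t : CommTree) : t.size ≤ t.leaves * t.maxLabel := by
  induction t with
  | leaf n => simp [size, leaves, maxLabel]
  | node l r hl hr =>
    simp only [size, leaves, maxLabel, add_mul]
    exact add_le_add (hl.trans (Nat.mul_le_mul_left _ (le_max_left _ _)))
      (hr.trans (Nat.mul_le_mul_left _ (le_max_right _ _)))

theorem leaves_erase (t : CommTree) : t.erase.leaves = t.leaves := by
  induction t with
  | leaf n => rfl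
  | node l r hl hr => simp [erase, leaves, hl, hr]

instance sub_normal [h : ∀ n, (N n).Normal] (t : CommTree) : (t.sub N).Normal := by
  induction t with
  | leaf n => exact h n
  | node l r hl hr => exact commutator_normal _ _

instance upper_normal [h : ∀ n, (N n).Normal] (t : CommTree) : (t.upper N).Normal := by
  induction t with
  | leaf n => exact h (n + 1)
  | node l r hl hr => unfold upper; infer_instance

theorem val_conj [h : ∀ n, (N n).Normal] (t : CommTree) {x : G} (hx : x ∈ t.val N) (g : G) :
    g * x * g⁻¹ ∈ t.val N := by
  induction t generalizing x with
  | leaf n => exact (h n).conj_mem x hx g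
  | node l r hl hr =>
    obtain ⟨a, ha, b, hb, rfl⟩ := hx
    exact ⟨_, hl ha, _, hr hb, by group⟩

theorem one_mem_val (t : CommTree) : (1 : G) ∈ t.val N := by
  induction t with
  | leaf n => exact (N n).one_mem
  | node l r hl hr => exact ⟨1, hl, 1, hr, by group⟩

theorem val_subset_sub (t : CommTree) : t.val N ⊆ t.sub N := by
  induction t with
  | leaf n => exact subset_rfl
  | node l r hl hr =>
    rintro _ ⟨a, ha, b, hb, rfl⟩
    have := commutator_mem_commutator (inv_mem (hl ha)) (inv_mem (hr hb))
    simpa [commutatorElement_def, sub] using this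

end CommTree

/-! ### Commutator calculus modulo a normal subgroup. -/

section CommutatorLemmas

variable {G : Type v} [Group G]

theorem normal_closure_of_conj {S : Set G} (h : ∀ x ∈ S, ∀ g : G, g * x * g⁻¹ ∈ S) :
    (closure S).Normal := by
  have : normalClosure S = closure S := by
    refine le_antisymm ?_ closure_le_normalClosure
    refine closure_le _ |>.2 fun x hx => ?_
    obtain ⟨a, ha, hax⟩ := Group.mem_conjugatesOfSet_iff.1 hx
    obtain ⟨c, rfl⟩ := isConj_iff.1 hax
    exact subset_closure (h a ha c)
  rw [← this]; infer_instance

theorem mem_iff_commute_mk (K : Subgroup G) [K.Normal] (a b : G) :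
    ⁅a, b⁆ ∈ K ↔ Commute (a : G ⧸ K) (b : G ⧸ K) := by
  rw [← commutatorElement_eq_one_iff_commute, ← QuotientGroup.eq_one_iff]
  rfl

theorem mem_iff_commute_mk' (K : Subgroup G) [K.Normal] (a b : G) :
    a⁻¹ * b⁻¹ * a * b ∈ K ↔ Commute (a : G ⧸ K) (b : G ⧸ K) := by
  have : a⁻¹ * b⁻¹ * a * b = ⁅a⁻¹, b⁻¹⁆ := by simp [commutatorElement_def]
  rw [this, mem_iff_commute_mk]
  simp

theorem commutator_closure_le {A B : Set G} (K : Subgroup G) [K.Normal]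
    (h : ∀ a ∈ A, ∀ b ∈ B, ⁅a, b⁆ ∈ K) : ⁅closure A, closure B⁆ ≤ K := by
  have key : ∀ b : G, ∀ S : Set G, (∀ a ∈ S, ⁅a, b⁆ ∈ K) → ∀ a ∈ closure S, ⁅a, b⁆ ∈ K := by
    intro b S hS a ha
    induction ha using closure_induction with
    | mem x hx => exact hS x hx
    | one => simp
    | mul x y _ _ hx hy =>
      rw [mem_iff_commute_mk] at *
      exact hx.mul_left hy
    | inv x _ hx =>
      rw [mem_iff_commute_mk] at *
      exact hx.inv_left
  have swap : ∀ a b : G, ⁅a, b⁆ ∈ K → ⁅b, a⁆ ∈ K := fun a b hab => by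
    rw [mem_iff_commute_mk] at *; exact hab.symm
  rw [commutator_le]
  intro a ha b hb
  refine key b A (fun a ha => ?_) a ha
  exact swap _ _ (key a B (fun b hb => swap _ _ (h a ha b hb)) b hb)

theorem commutator_sup_le_left {A B C K : Subgroup G} [K.Normal] (h₁ : ⁅A, C⁆ ≤ K)
    (h₂ : ⁅B, C⁆ ≤ K) : ⁅A ⊔ B, C⁆ ≤ K := by
  rw [← closure_eq C, sup_eq_closure]
  refine commutator_closure_le K ?_
  rintro a (ha | ha) b hb
  · exact h₁ (commutator_mem_commutator ha hb)
  · exact h₂ (commutator_mem_commutator ha hb)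

theorem commutator_le_iff_map_mk (A B K : Subgroup G) [K.Normal] :
    ⁅A, B⁆ ≤ K ↔ ⁅A.map (QuotientGroup.mk' K), B.map (QuotientGroup.mk' K)⁆ = ⊥ := by
  rw [← map_commutator, Subgroup.map_eq_bot_iff, QuotientGroup.ker_mk']

/-- The three subgroups lemma in `G ⧸ K`. -/
theorem commutator_commutator_le_of_rotate {A B C K : Subgroup G} [K.Normal]
    (h₁ : ⁅⁅B, C⁆, A⁆ ≤ K) (h₂ : ⁅⁅C, A⁆, B⁆ ≤ K) : ⁅⁅A, B⁆, C⁆ ≤ K := by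
  rw [commutator_le_iff_map_mk, map_commutator] at *
  exact commutator_commutator_eq_bot_of_rotate h₁ h₂

/-- As `[a, b]` commutes with `a`, `b⁻¹ a ^ n b = (a [a, b]) ^ n = a ^ n [a, b] ^ n`. Replacing `a ^
n` by `a'` is harmless, since the quotient commutes with `b`. -/
theorem commutator_eq_zpow_left {a b a' : G} (n : ℤ) (h₁ : Commute (a⁻¹ * b⁻¹ * a * b) a)
    (h₂ : Commute (a' * (a ^ n)⁻¹) b) :
    a'⁻¹ * b⁻¹ * a' * b = (a⁻¹ * b⁻¹ * a * b) ^ n := by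
  have h3 := h₁.symm.mul_zpow n
  have h4 : (b⁻¹ * a * b) ^ n = b⁻¹ * a ^ n * b := by
    have := conj_zpow (i := n) (a := b⁻¹) (b := a)
    simpa using this
  rw [show a * (a⁻¹ * b⁻¹ * a * b) = b⁻¹ * a * b by group, h4] at h3
  calc a'⁻¹ * b⁻¹ * a' * b
      = (a ^ n)⁻¹ * ((a' * (a ^ n)⁻¹)⁻¹ * b⁻¹ * (a' * (a ^ n)⁻¹) * b) * (b⁻¹ * a ^ n * b) := by
        group
    _ = (a⁻¹ * b⁻¹ * a * b) ^ n := by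
        have h5 := h₂.inv_inv.eq
        rw [h3, h5]
        group

theorem commutator_eq_zpow_right {a b b' : G} (n : ℤ) (h₁ : Commute (a⁻¹ * b⁻¹ * a * b) b)
    (h₂ : Commute (b' * (b ^ n)⁻¹) a) :
    a⁻¹ * b'⁻¹ * a * b' = (a⁻¹ * b⁻¹ * a * b) ^ n := by
  have e : ∀ x y : G, x⁻¹ * y⁻¹ * x * y = (y⁻¹ * x⁻¹ * y * x)⁻¹ := fun x y => by group
  rw [e a b] at h₁ ⊢
  rw [e a b', commutator_eq_zpow_left n (by simpa using h₁.inv_left) h₂, inv_zpow]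

end CommutatorLemmas

/-! ### Relabelled commutators along the derived series. -/

namespace CommTree

section Derived

variable {G : Type v} [Group G]

instance derivedSeries_forall_normal : ∀ n, (derivedSeries G n).Normal := derivedSeries_normal G

theorem sub_eq_closure (N : ℕ → Subgroup G) [∀ n, (N n).Normal] (t : CommTree) :
    t.sub N = closure (t.val N) := by
  refine le_antisymm ?_ ((closure_le _).2 (t.val_subset_sub N))
  induction t with
  | leaf n => simp [sub, val]
  | node l r hl hr =>
    have hn : (closure ((node l r).val N)).Normal :=
      normal_closure_of_conj fun x hx g => (node l r).val_conj N hx g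
    refine (commutator_mono hl hr).trans (commutator_closure_le _ fun a ha b hb => ?_)
    rw [mem_iff_commute_mk, ← mem_iff_commute_mk']
    exact subset_closure ⟨a, ha, b, hb, rfl⟩

local notation "D" => derivedSeries G

theorem sub_le_derivedSeries_maxLabel (t : CommTree) : t.sub D ≤ D t.maxLabel := by
  induction t with
  | leaf n => exact le_rfl
  | node l r hl hr =>
    rcases le_total l.maxLabel r.maxLabel with h | h
    · simpa [maxLabel, sub, h] using (commutator_le_right _ _).trans hr
    · simpa [maxLabel, sub, h] using (commutator_le_left _ _).trans hl

/-- By three subgroups, commutation with `D J` moves into either branch, down to a leaf, where `⁅D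
n, D J⁆ ≤ D (n + 1)` for `n ≤ J`. -/
theorem commutator_sub_le_upper (t : CommTree) {J : ℕ} (hJ : t.maxLabel ≤ J) :
    ⁅t.sub D, D J⁆ ≤ t.upper D := by
  induction t with
  | leaf n => exact commutator_mono le_rfl (derivedSeries_antitone G hJ)
  | node l r hl hr =>
    simp only [maxLabel, max_le_iff] at hJ
    refine commutator_commutator_le_of_rotate (K := (node l r).upper D) ?_ ?_
    · rw [commutator_comm]
      exact (commutator_mono le_rfl (hr hJ.2)).trans le_sup_right
    · rw [commutator_comm (D J)]
      exact (commutator_mono (hl hJ.1) le_rfl).trans le_sup_left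

/-- The power is taken in the branch with the greatest label: its entry lies in `D t.maxLabel`,
hence commutes with the whole commutator modulo `upper`. -/
theorem exists_val_eq_zpow (t : CommTree) {v : G} (hv : v ∈ t.val D) (n : ℤ) :
    ∃ v' ∈ t.val D, (v' : G ⧸ t.upper D) = (v : G ⧸ t.upper D) ^ n := by
  induction t generalizing v with
  | leaf k => exact ⟨v ^ n, (D k).zpow_mem hv n, rfl⟩
  | node l r hl hr =>
    obtain ⟨a, ha, b, hb, rfl⟩ := hv
    have hc := (node l r).val_subset_sub D ⟨a, ha, b, hb, rfl⟩
    rcases le_total r.maxLabel l.maxLabel with h | h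
    · obtain ⟨a', ha', h'⟩ := hl ha
      refine ⟨_, ⟨a', ha', b, hb, rfl⟩, ?_⟩
      have hu : a' * (a ^ n)⁻¹ ∈ l.upper D := by
        rw [← QuotientGroup.eq_one_iff, QuotientGroup.mk_mul, h']
        simp
      have hM := (node l r).commutator_sub_le_upper (J := l.maxLabel) (G := G)
        (by simp [maxLabel, h])
      have h1 := hM (commutator_mem_commutator hc
        (l.sub_le_derivedSeries_maxLabel (l.val_subset_sub D ha)))
      have h2 : ⁅a' * (a ^ n)⁻¹, b⁆ ∈ (node l r).upper D := (le_sup_left : _ ≤ (node l r).upper D)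
          (commutator_mem_commutator hu (r.val_subset_sub D hb))
      rw [mem_iff_commute_mk] at h1 h2
      have := commutator_eq_zpow_left n h1 (by simpa using h2)
      simpa using this
    · obtain ⟨b', hb', h'⟩ := hr hb
      refine ⟨_, ⟨a, ha, b', hb', rfl⟩, ?_⟩
      have hu : b' * (b ^ n)⁻¹ ∈ r.upper D := by
        rw [← QuotientGroup.eq_one_iff, QuotientGroup.mk_mul, h']
        simp
      have hM := (node l r).commutator_sub_le_upper (J := r.maxLabel) (G := G)
        (by simp [maxLabel, h])
      have h1 := hM (commutator_mem_commutator hc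
        (r.sub_le_derivedSeries_maxLabel (r.val_subset_sub D hb)))
      have h2 : ⁅a, b' * (b ^ n)⁻¹⁆ ∈ (node l r).upper D :=
        (le_sup_right : _ ≤ (node l r).upper D)
          (commutator_mem_commutator (l.val_subset_sub D ha) hu)
      rw [mem_iff_commute_mk] at h1 h2
      have := commutator_eq_zpow_right n h1 (by simpa using h2.symm)
      simpa using this

/-- `t.upper N` is contained in `K` as soon as `K` contains the iterated commutator subgroups of the
trees of the same shape whose size is greater by one. -/
theorem upper_le (N : ℕ → Subgroup G) [∀ n, (N n).Normal] (t : CommTree) (K : Subgroup G)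
    [K.Normal] (h : ∀ t' : CommTree, t'.erase = t.erase → t'.size = t.size + 1 → t'.sub N ≤ K) :
    t.upper N ≤ K := by
  induction t generalizing K with
  | leaf n => exact h (leaf (n + 1)) rfl rfl
  | node l r hl hr =>
    have key : ∀ S : Subgroup G, [S.Normal] → ∃ C : Subgroup G, C.Normal ∧
        ∀ X : Subgroup G, X ≤ C ↔ ⁅X, S⁆ ≤ K := by
      intro S _
      -- The preimage of the centralizer is the largest subgroup `C` with `⁅C, S⁆ ≤ K`; the
      -- induction hypothesis for one branch is applied to it.
      refine ⟨(centralizer (S.map (QuotientGroup.mk' K) : Set (G ⧸ K))).comap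
        (QuotientGroup.mk' K), ?_, fun X => ?_⟩
      · have : (S.map (QuotientGroup.mk' K)).Normal :=
          Normal.map inferInstance _ (QuotientGroup.mk'_surjective K)
        infer_instance
      · rw [commutator_le_iff_map_mk, commutator_eq_bot_iff_le_centralizer, map_le_iff_le_comap]
    refine sup_le ?_ ?_
    · obtain ⟨C, _, hC⟩ := key (r.sub N)
      rw [← hC]
      refine hl C fun t' h₁ h₂ => (hC _).2 (h (node t' r) ?_ ?_)
      · simp [erase, h₁]
      · simp only [size, h₂]; ring
    · obtain ⟨C, _, hC⟩ := key (l.sub N)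
      rw [commutator_comm, ← hC]
      refine hr C fun t' h₁ h₂ => (hC _).2 ?_
      rw [commutator_comm]
      refine h (node l t') ?_ ?_
      · simp [erase, h₁]
      · simp only [size, h₂]; ring

theorem val_subset_val_erase (t : CommTree) : t.val D ⊆ t.erase.val D := by
  induction t with
  | leaf n => exact derivedSeries_antitone G (Nat.zero_le n)
  | node l r hl hr =>
    rintro _ ⟨a, ha, b, hb, rfl⟩
    exact ⟨a, hl ha, b, hr hb, rfl⟩

theorem derivedSeries_height_le (t : CommTree) (ht : t.erase = t) : D t.height ≤ t.sub D := by
  induction t with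
  | leaf n =>
    obtain rfl : 0 = n := by simpa [erase] using ht
    exact le_rfl
  | node l r hl hr =>
    simp only [erase, node.injEq] at ht
    rw [height, derivedSeries_succ]
    exact commutator_mono ((derivedSeries_antitone G (le_max_left _ _)).trans (hl ht.1))
      ((derivedSeries_antitone G (le_max_right _ _)).trans (hr ht.2))

end Derived
end CommTree
-- Indices bounded by counting values.
variable {G : Type v} [Group G]

/-- `K` has finite index in `P`, bounded in terms of the number of elements of `W` that lie in `P`
but not in `K`. -/
structure BoundedOver (W : Set G) (K P : Subgroup G) : Prop where
  le : K ≤ P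
  ne_zero : K.relIndex P ≠ 0
  le_two_pow : K.relIndex P ≤ 2 ^ (W ∩ (P \ K)).ncard

namespace BoundedOver

variable {W : Set G} {K P Q : Subgroup G}

theorem refl (W : Set G) (K : Subgroup G) : BoundedOver W K K :=
  ⟨le_rfl, by simp, by simp⟩

theorem trans (hW : W.Finite) (h₁ : BoundedOver W K P) (h₂ : BoundedOver W P Q) :
    BoundedOver W K Q := by
  refine ⟨h₁.le.trans h₂.le, relIndex_ne_zero_trans h₁.ne_zero h₂.ne_zero, ?_⟩
  rw [← relIndex_mul_relIndex K P Q h₁.le h₂.le]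
  refine (Nat.mul_le_mul h₁.le_two_pow h₂.le_two_pow).trans ?_
  rw [← pow_add, ← Set.ncard_union_eq ?_ (hW.inter_of_left _) (hW.inter_of_left _)]
  · refine Nat.pow_le_pow_right two_pos (Set.ncard_le_ncard ?_ (hW.inter_of_left _))
    rintro x (⟨hx, hp, hk⟩ | ⟨hx, hp, hk⟩)
    · exact ⟨hx, h₂.le hp, hk⟩
    · exact ⟨hx, hp, fun h => hk (h₁.le h)⟩
  · rw [Set.disjoint_left]
    rintro x ⟨-, hp, -⟩ ⟨-, -, h⟩
    exact h hp

/-- Every coset other than `P` has a representative in `W ∩ (Q \ P)`, so the index is at most `n + 1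
≤ 2 ^ n`. -/
theorem of_cover (hW : W.Finite) (hle : P ≤ Q) (h : ∀ g ∈ Q, ∃ w ∈ W, w⁻¹ * g ∈ P) :
    BoundedOver W P Q := by
  have hfin := (hW.inter_of_left (Q \ P : Set G)).to_subtype
  let f : Option ↥(W ∩ (Q \ P)) → Q ⧸ P.subgroupOf Q := fun o =>
    o.elim ((1 : Q) : Q ⧸ P.subgroupOf Q) fun w => ((⟨w.1, w.2.2.1⟩ : Q) : Q ⧸ P.subgroupOf Q)
  have hf : Function.Surjective f := by
    intro q
    induction q using QuotientGroup.induction_on with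
    | H g =>
      obtain ⟨w, hw, hwg⟩ := h g g.2
      by_cases hg : g.1 ∈ P
      · refine ⟨none, QuotientGroup.eq.2 ?_⟩
        simpa [mem_subgroupOf] using hg
      · have hwQ : w ∈ Q := by
          have := Q.mul_mem g.2 (Q.inv_mem (hle hwg))
          simpa using this
        have hwP : w ∉ P := fun hwP => hg (by simpa using P.mul_mem hwP hwg)
        refine ⟨some ⟨w, hw, hwQ, hwP⟩, QuotientGroup.eq.2 ?_⟩
        simpa [mem_subgroupOf] using hwg
  have hfinQ : Finite (Q ⧸ P.subgroupOf Q) := Finite.of_surjective f hf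
  refine ⟨hle, Nat.card_pos.ne', ?_⟩
  have := Nat.card_le_card_of_surjective f hf
  rw [Finite.card_option] at this
  exact this.trans Nat.lt_two_pow_self

/-- Adjoin the elements `v` of `V` singly. Each new coset contains some `v ^ n`, which agrees modulo
`K` with an element of `V`. -/
theorem sup_closure {V : Set G} {A K : Subgroup G} [K.Normal] (hW : W.Finite) (hVW : V ⊆ W)
    (hc : ∀ a ∈ V, ∀ b ∈ V, ⁅a, b⁆ ∈ K)
    (hp : ∀ v ∈ V, ∀ n : ℤ, ∃ v' ∈ V, (v' : G ⧸ K) = (v : G ⧸ K) ^ n)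
    (h : BoundedOver W A K) : BoundedOver W A (K ⊔ closure V) := by
  have hcc := commutator_closure_le K hc
  suffices ∀ s : Set G, s.Finite → s ⊆ V → BoundedOver W A (K ⊔ closure s) from
    this V (hW.subset hVW) subset_rfl
  intro s hsf
  induction s, hsf using Set.Finite.induction_on with
  | empty => simpa using h
  | @insert v s _ _ ih =>
    intro hsV
    obtain ⟨hv, hs⟩ := Set.insert_subset_iff.1 hsV
    refine (ih hs).trans hW (of_cover hW ?_ ?_)
    · exact sup_le_sup_left (Subgroup.closure_mono (Set.subset_insert _ _)) _
    · have hz : zpowers v ≤ closure V := by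
        rw [zpowers_le]; exact subset_closure hv
      have hnorm : zpowers v ≤ normalizer (K ⊔ closure s : Subgroup G) := by
        rw [le_normalizer_iff_commutator_le_left]
        refine (commutator_sup_le_left (K := K) (commutator_le_left _ _) ?_).trans le_sup_left
        exact (commutator_mono (Subgroup.closure_mono hs) hz).trans hcc
      intro g hg
      rw [Set.insert_eq, Subgroup.closure_union, ← zpowers_eq_closure, sup_left_comm, ← SetLike.mem_coe,
        coe_mul_of_left_le_normalizer_right _ _ hnorm] at hg
      obtain ⟨_, ⟨n, rfl⟩, p, hp', rfl⟩ := hg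
      obtain ⟨v', hv', h'⟩ := hp v hv n
      refine ⟨v', hVW hv', ?_⟩
      have : v'⁻¹ * v ^ n ∈ K := QuotientGroup.eq.1 (by rw [h']; rfl)
      have := mul_mem ((le_sup_left : K ≤ K ⊔ closure s) this) hp'
      simpa [mul_assoc] using this

end BoundedOver

/-! ### Filtration of the verbal subgroup by tree size. -/

namespace CommTree

local notation "D" => derivedSeries G

/-- The product of the subgroups `t'.sub D` for the trees `t'` of the shape of `t` and of size at
least `r`. -/
def layer (G : Type v) [Group G] (t : CommTree) (r : ℕ) : Subgroup G :=
  closure (⋃ t' ∈ {t' : CommTree | t'.erase = t.erase ∧ r ≤ t'.size},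
    t'.val (derivedSeries G))

theorem sub_le_layer {t t' : CommTree} {r : ℕ} (h : t'.erase = t.erase) (hr : r ≤ t'.size) :
    t'.sub D ≤ layer G t r := by
  rw [sub_eq_closure]
  exact closure_mono (Set.subset_biUnion_of_mem (u := fun t' : CommTree => t'.val D) ⟨h, hr⟩)

instance layer_normal (t : CommTree) (r : ℕ) : (layer G t r).Normal := by
  refine normal_closure_of_conj fun x hx g => ?_
  simp only [Set.mem_iUnion] at hx ⊢
  obtain ⟨t', ht', hx⟩ := hx
  exact ⟨t', ht', t'.val_conj _ hx g⟩

theorem leaves_pos (t : CommTree) : 0 < t.leaves := by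
  induction t with
  | leaf n => exact one_pos
  | node l r hl hr => exact Nat.add_pos_left hl _

/-- If the labels sum to at least `t.leaves * d`, some label is at least `d`. This starts the
descent. -/
theorem layer_le_derivedSeries (t : CommTree) (d : ℕ) : layer G t (t.leaves * d) ≤ D d := by
  refine (closure_le _).2 (Set.iUnion₂_subset fun t' ht' => ?_)
  refine (t'.val_subset_sub D).trans (t'.sub_le_derivedSeries_maxLabel.trans ?_)
  refine derivedSeries_antitone G ?_
  have h := ht'.2.trans t'.size_le
  rw [← leaves_erase t', ht'.1, leaves_erase] at h
  refine Nat.le_of_mul_le_mul_left h ?_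
  exact t.leaves_pos

theorem boundedOver_layer (t : CommTree) (ht : t.erase = t) (hW : (t.val D).Finite) (d r : ℕ)
    (h : BoundedOver (t.val D) (D d) (D d ⊔ layer G t (r + 1))) :
    BoundedOver (t.val D) (D d) (D d ⊔ layer G t r) := by
  let V : Set G := ⋃ t' ∈ {t' : CommTree | t'.erase = t.erase ∧ t'.size = r}, t'.val D
  have hV : ∀ x ∈ V, ∃ t' : CommTree, (t'.erase = t.erase ∧ t'.size = r) ∧ x ∈ t'.val D := by
    intro x hx
    simpa [V] using hx
  have hVmem : ∀ t' : CommTree, t'.erase = t.erase → t'.size = r → t'.val D ⊆ V :=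
    fun t' h₁ h₂ => Set.subset_biUnion_of_mem (u := fun t' : CommTree => t'.val D) ⟨h₁, h₂⟩
  have hupper : ∀ t' : CommTree, t'.erase = t.erase → t'.size = r →
      t'.upper D ≤ D d ⊔ layer G t (r + 1) := by
    intro t' h₁ h₂
    refine t'.upper_le _ _ fun t'' h₃ h₄ => ?_
    exact (sub_le_layer (h₃.trans h₁) (by omega)).trans le_sup_right
  -- Commutators of two trees of size `r` are absorbed by `upper` of the tree with the smaller
  -- greatest label.
  have hcomm : ∀ t₁ t₂ : CommTree, t₁.erase = t.erase → t₁.size = r →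
      t₁.maxLabel ≤ t₂.maxLabel → ⁅t₁.sub D, t₂.sub D⁆ ≤ D d ⊔ layer G t (r + 1) := by
    intro t₁ t₂ h₁ h₂ h₃
    exact (commutator_mono le_rfl t₂.sub_le_derivedSeries_maxLabel).trans
      ((t₁.commutator_sub_le_upper h₃).trans (hupper t₁ h₁ h₂))
  have key := BoundedOver.sup_closure (V := V) hW ?_ ?_ ?_ h
  · have : D d ⊔ layer G t r = D d ⊔ layer G t (r + 1) ⊔ closure V := by
      rw [sup_assoc]
      congr 1
      rw [layer, layer, ← Subgroup.closure_union]
      congr 1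
      ext x
      simp only [V, Set.mem_union, Set.mem_iUnion, Set.mem_ofPred_eq, exists_prop]
      constructor
      · rintro ⟨t', ⟨h₁, h₂⟩, hx⟩
        rcases h₂.eq_or_lt with h₂ | h₂
        · exact Or.inr ⟨t', ⟨h₁, h₂.symm⟩, hx⟩
        · exact Or.inl ⟨t', ⟨h₁, h₂⟩, hx⟩
      · rintro (⟨t', ⟨h₁, h₂⟩, hx⟩ | ⟨t', ⟨h₁, h₂⟩, hx⟩)
        · exact ⟨t', ⟨h₁, by omega⟩, hx⟩
        · exact ⟨t', ⟨h₁, h₂.ge⟩, hx⟩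
    rw [this]
    exact key
  · intro x hx
    obtain ⟨t', ⟨h₁, -⟩, hx⟩ := hV x hx
    rw [← ht, ← h₁]
    exact t'.val_subset_val_erase hx
  · intro a ha b hb
    obtain ⟨t₁, ⟨h₁, h₁'⟩, ha⟩ := hV a ha
    obtain ⟨t₂, ⟨h₂, h₂'⟩, hb⟩ := hV b hb
    have hab := commutator_mem_commutator (t₁.val_subset_sub D ha) (t₂.val_subset_sub D hb)
    rcases le_total t₁.maxLabel t₂.maxLabel with h₃ | h₃
    · exact hcomm t₁ t₂ h₁ h₁' h₃ hab
    · rw [commutator_comm] at hab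
      exact hcomm t₂ t₁ h₂ h₂' h₃ hab
  · intro v hv n
    obtain ⟨t', ⟨h₁, h₂⟩, hv⟩ := hV v hv
    obtain ⟨v', hv', h'⟩ := t'.exists_val_eq_zpow hv n
    refine ⟨v', hVmem t' h₁ h₂ hv', ?_⟩
    have := congrArg (QuotientGroup.map _ (D d ⊔ layer G t (r + 1)) (MonoidHom.id G)
      (hupper t' h₁ h₂)) h'
    rw [map_zpow] at this
    exact this

/-- The subgroup generated by the values of an outer commutator word has finite index over each
term of the derived series, bounded in terms of the number of values outside of this term. -/
theorem boundedOver_sub (t : CommTree) (ht : t.erase = t) (hW : (t.val D).Finite) (d : ℕ) :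
    BoundedOver (t.val D) (D d) (D d ⊔ t.sub D) := by
  have hbase : BoundedOver (t.val D) (D d) (D d ⊔ layer G t 0) := by
    refine Nat.decreasingInduction
      (motive := fun r _ => BoundedOver (t.val D) (D d) (D d ⊔ layer G t r))
      (fun r _ h => boundedOver_layer t ht hW d r h) ?_ (Nat.zero_le (t.leaves * d))
    rw [sup_eq_left.2 (layer_le_derivedSeries t d)]
    exact .refl _ _
  convert hbase using 2
  refine le_antisymm (sub_le_layer rfl (Nat.zero_le _)) ?_
  rw [sub_eq_closure]
  refine closure_mono (Set.iUnion₂_subset fun t' ht' => ?_)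
  rw [← ht, ← ht'.1]
  exact t'.val_subset_val_erase

end CommTree
-- Dicman's lemma with an explicit bound.
section Dicman

variable {Q : Type v} [Group Q]

/-- Uses `b * a = a * (a⁻¹ * b * a)`, which moves `a` to the front without lengthening the word. -/
theorem exists_gather [DecidableEq Q] {S : Set Q} (hS : ∀ a ∈ S, ∀ b ∈ S, a⁻¹ * b * a ∈ S) {a : Q}
    (ha : a ∈ S) (w : List Q) (hw : ∀ x ∈ w, x ∈ S) (haw : a ∈ w) :
    ∃ w' : List Q, (∀ x ∈ w', x ∈ S) ∧ w'.length + 1 = w.length ∧ w.prod = a * w'.prod := by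
  induction w with
  | nil => simp at haw
  | cons b w ih =>
    simp only [List.mem_cons, forall_eq_or_imp] at hw
    by_cases hab : a = b
    · subst hab
      exact ⟨w, hw.2, rfl, rfl⟩
    · obtain ⟨w', h₁, h₂, h₃⟩ := ih hw.2 ((List.mem_cons.1 haw).resolve_left hab)
      refine ⟨(a⁻¹ * b * a) :: w', ?_, by simp [h₂], by simp [h₃]; group⟩
      simpa using ⟨hS a ha b hw.1, h₁⟩

/-- The products `a₁ ^ k₁ * ⋯ * aₙ ^ kₙ` for the list `a₁, …, aₙ`, where each exponent is less than
the order. -/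
noncomputable def orderedProducts [DecidableEq Q] : List Q → Finset Q
  | [] => {1}
  | a :: l => Finset.image₂ (fun k h => a ^ k * h) (Finset.range (orderOf a)) (orderedProducts l)

theorem card_orderedProducts_le [DecidableEq Q] (l : List Q) :
    (orderedProducts l).card ≤ (l.map orderOf).prod := by
  induction l with
  | nil => simp [orderedProducts]
  | cons a l ih =>
    simp only [orderedProducts, List.map_cons, List.prod_cons]
    refine (Finset.card_image₂_le _ _ _).trans ?_
    rw [Finset.card_range]
    exact Nat.mul_le_mul_left _ ih

/-- In a shortest word, gather as many copies of `a` in front as possible; minimality keeps their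
number below the order of `a`. By maximality, no equally long word for the remainder contains `a`.
This is why `hlet` speaks of all shortest words. -/
theorem mem_orderedProducts [DecidableEq Q] {S : Set Q}
    (hS : ∀ a ∈ S, ∀ b ∈ S, a⁻¹ * b * a ∈ S) (hfin : ∀ a ∈ S, IsOfFinOrder a) (l : List Q)
    (hl : ∀ a ∈ l, a ∈ S) (w : List Q) (hw : ∀ x ∈ w, x ∈ S)
    (hmin : ∀ w' : List Q, (∀ x ∈ w', x ∈ S) → w'.prod = w.prod → w.length ≤ w'.length)
    (hlet : ∀ w' : List Q, (∀ x ∈ w', x ∈ S) → w'.prod = w.prod → w'.length = w.length →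
      ∀ x ∈ w', x ∈ l) :
    w.prod ∈ orderedProducts l := by
  induction l generalizing w with
  | nil =>
    have : w = [] := List.eq_nil_iff_forall_not_mem.2 fun x hx => by
      simpa using hlet w hw rfl rfl x hx
    simp [this, orderedProducts]
  | cons a l ih =>
    simp only [List.mem_cons, forall_eq_or_imp] at hl
    let p : ℕ → Prop := fun k => ∃ w' : List Q, (∀ x ∈ w', x ∈ S) ∧ w'.length + k = w.length ∧
      w.prod = a ^ k * w'.prod
    classical
    have hp0 : p 0 := ⟨w, hw, rfl, by simp⟩
    obtain ⟨w', h₁, h₂, h₃⟩ : p (Nat.findGreatest p w.length) :=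
      Nat.findGreatest_spec (Nat.zero_le _) hp0
    have hmax : ¬ p (Nat.findGreatest p w.length + 1) := by
      rintro hk
      have hle : Nat.findGreatest p w.length + 1 ≤ w.length := by
        obtain ⟨w'', -, h, -⟩ := hk
        omega
      have := Nat.le_findGreatest hle hk
      omega
    set k := Nat.findGreatest p w.length
    have hk : k < orderOf a := by
      by_contra! hk
      have hpos := (hfin a hl.1).orderOf_pos
      have := hmin (List.replicate (k - orderOf a) a ++ w') ?_ ?_
      · simp at this
        omega
      · intro x hx
        rcases List.mem_append.1 hx with hx | hx
        · rw [List.eq_of_mem_replicate hx]; exact hl.1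
        · exact h₁ x hx
      · rw [List.prod_append, List.prod_replicate, h₃]
        congr 1
        conv_rhs => rw [← Nat.sub_add_cancel hk, pow_add, pow_orderOf_eq_one, mul_one]
    have hrep : ∀ w'' : List Q, (∀ x ∈ w'', x ∈ S) → w''.prod = w'.prod →
        (∀ x ∈ List.replicate k a ++ w'', x ∈ S) ∧
          (List.replicate k a ++ w'').prod = w.prod := by
      intro w'' h h'
      refine ⟨fun x hx => ?_, ?_⟩
      · rcases List.mem_append.1 hx with hx | hx
        · rw [List.eq_of_mem_replicate hx]; exact hl.1
        · exact h x hx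
      · rw [List.prod_append, List.prod_replicate, h₃, h']
    rw [h₃, orderedProducts]
    refine Finset.mem_image₂_of_mem (Finset.mem_range.2 hk) (ih hl.2 w' h₁ ?_ ?_)
    · intro w'' h h'
      have := hmin _ (hrep w'' h h').1 (hrep w'' h h').2
      simp at this
      omega
    · intro w'' h h' h'' x hx
      have := hlet _ (hrep w'' h h').1 (hrep w'' h h').2 (by simp; omega) x
        (List.mem_append_right _ hx)
      refine (List.mem_cons.1 this).resolve_left fun hxa => hmax ?_
      subst hxa
      obtain ⟨u, hu₁, hu₂, hu₃⟩ := exists_gather hS hl.1 w'' h hx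
      refine ⟨u, hu₁, by omega, ?_⟩
      rw [h₃, ← h', hu₃, pow_succ, mul_assoc]

/-- **Dicman's lemma**: a finite set `S` of elements of finite order that is closed under
conjugation by its own elements generates a finite subgroup. -/
theorem closure_finite_and_card_le (S : Finset Q) (hS : ∀ a ∈ S, ∀ b ∈ S, a⁻¹ * b * a ∈ S)
    (hfin : ∀ a ∈ S, IsOfFinOrder a) :
    Finite (closure (S : Set Q)) ∧ Nat.card (closure (S : Set Q)) ≤ ∏ a ∈ S, orderOf a := by
  classical
  have hword : ∀ g ∈ closure (S : Set Q), ∃ w : List Q, (∀ x ∈ w, x ∈ (S : Set Q)) ∧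
      w.prod = g := by
    intro g hg
    induction hg using closure_induction with
    | mem x hx => exact ⟨[x], by simpa using hx, by simp⟩
    | one => exact ⟨[], by simp, rfl⟩
    | mul x y _ _ hx hy =>
      obtain ⟨w, hw, rfl⟩ := hx
      obtain ⟨w', hw', rfl⟩ := hy
      exact ⟨w ++ w', fun z hz => (List.mem_append.1 hz).elim (hw z) (hw' z), by simp⟩
    | inv x _ hx =>
      obtain ⟨w, hw, rfl⟩ := hx
      clear * - hw hfin
      induction w with
      | nil => exact ⟨[], by simp, by simp⟩
      | cons a w ih =>
        simp only [List.mem_cons, forall_eq_or_imp] at hw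
        obtain ⟨w', hw', h'⟩ := ih hw.2
        refine ⟨w' ++ List.replicate (orderOf a - 1) a, fun z hz => ?_, ?_⟩
        · rcases List.mem_append.1 hz with hz | hz
          · exact hw' z hz
          · rw [List.eq_of_mem_replicate hz]; exact hw.1
        · have hpos := (hfin a hw.1).orderOf_pos
          rw [List.prod_append, List.prod_replicate, h', List.prod_cons, mul_inv_rev]
          congr 1
          rw [eq_inv_iff_mul_eq_one, ← pow_succ, Nat.sub_add_cancel hpos, pow_orderOf_eq_one]
  have hsub : (closure (S : Set Q) : Set Q) ⊆ orderedProducts S.toList := by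
    intro g hg
    have hex : ∃ n, ∃ w : List Q, (∀ x ∈ w, x ∈ (S : Set Q)) ∧ w.prod = g ∧ w.length = n := by
      obtain ⟨w, hw, h⟩ := hword g hg
      exact ⟨_, w, hw, h, rfl⟩
    obtain ⟨w, hw, rfl, hn⟩ := Nat.find_spec hex
    refine mem_orderedProducts (S := S) hS hfin S.toList (by simp) w hw ?_ ?_
    · intro w' h₁ h₂
      rw [hn]
      exact Nat.find_min' hex ⟨w', h₁, h₂, rfl⟩
    · intro w' h₁ _ _ x hx
      simpa using h₁ x hx
  refine ⟨(Finset.finite_toSet _).subset hsub, ?_⟩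
  calc Nat.card (closure (S : Set Q)) = (closure (S : Set Q) : Set Q).ncard := rfl
    _ ≤ (orderedProducts S.toList : Set Q).ncard := Set.ncard_le_ncard hsub (Finset.finite_toSet _)
    _ = (orderedProducts S.toList).card := Set.ncard_coe_finset _
    _ ≤ (S.toList.map orderOf).prod := card_orderedProducts_le _
    _ = ∏ a ∈ S, orderOf a := Finset.prod_map_toList _ _

end Dicman

/-! ### Perfect groups with common central powers. -/

section Perfect

open scoped IsMulCommutative

/-- The homomorphism that maps the standard basis to the elements `(z k, e k)`. -/
noncomputable def centralHom {H : Type v} [Group H] {κ : Type*} [Fintype κ] (z : κ → center H)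
    (e : κ → ℕ) : Multiplicative (κ → ℤ) →* H × (κ → Multiplicative ℤ) where
  toFun f := (((∏ k, z k ^ f.toAdd k : center H) : H),
    fun k => Multiplicative.ofAdd (e k * f.toAdd k))
  map_one' := by ext <;> simp
  map_mul' f f' := by
    refine Prod.ext ?_ ?_
    · simp only [Prod.fst_mul, ← Subgroup.coe_mul, ← Finset.prod_mul_distrib, ← zpow_add,
        toAdd_mul, Pi.add_apply]
    · funext k
      simp only [toAdd_mul, Pi.add_apply, mul_add, ofAdd_add, Prod.snd_mul, Pi.mul_apply]

theorem centralHom_apply {H : Type v} [Group H] {κ : Type*} [Fintype κ] (z : κ → center H)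
    (e : κ → ℕ) (f : Multiplicative (κ → ℤ)) :
    centralHom z e f = (((∏ k, z k ^ f.toAdd k : center H) : H),
      fun k => Multiplicative.ofAdd (e k * f.toAdd k)) := rfl

/-- A perfect group generated by finitely many finite conjugation-invariant sets, all of whose
elements have a common central power, is finite. -/
theorem finite_and_card_le_of_perfect {H : Type v} [Group H] (hH : commutator H = ⊤) {κ : Type*}
    [Fintype κ] (Y : κ → Finset H) (hY : ∀ k, ∀ y ∈ Y k, ∀ g : H, g * y * g⁻¹ ∈ Y k)
    (hgen : closure (⋃ k, (Y k : Set H)) = ⊤) (e : κ → ℕ) (he : ∀ k, 0 < e k)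
    (z : κ → center H) (hz : ∀ k, ∀ y ∈ Y k, y ^ e k = z k) {s : ℕ} (hs : ∀ k, e k ≤ s) :
    Finite H ∧ Nat.card H ≤ s ^ ∑ k, (Y k).card := by
  classical
  -- Each `y ∈ Y k` is lifted to `(y, k-th basis vector)`. Modulo the central subgroup `A` the lift
  -- has order dividing `e k`, yet `A` meets `H × 1` trivially because `e k ≠ 0`.
  let A : Subgroup (H × (κ → Multiplicative ℤ)) := (centralHom z e).range
  have hA : A.Normal := by
    refine ⟨?_⟩
    rintro _ ⟨f, rfl⟩ g
    refine ⟨f, Prod.ext ?_ ?_⟩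
    · have := mem_center_iff.1 (∏ k, z k ^ f.toAdd k : center H).2 g.1
      simp only [centralHom_apply, Prod.fst_mul, Prod.fst_inv, this, mul_inv_cancel_right]
    · simp only [Prod.snd_mul, Prod.snd_inv, mul_inv_cancel_comm]
  let ι : (Σ _ : κ, H) → H × (κ → Multiplicative ℤ) := fun p => (p.2, Pi.mulSingle p.1 (Multiplicative.ofAdd 1))
  let T : Finset (Σ _ : κ, H) := Finset.univ.sigma Y
  let S : Finset ((H × (κ → Multiplicative ℤ)) ⧸ A) := T.image fun p => (ι p : (H × (κ → Multiplicative ℤ)) ⧸ A)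
  have hSmem : ∀ a ∈ S, ∃ k, ∃ y ∈ Y k, ((ι ⟨k, y⟩ : H × (κ → Multiplicative ℤ)) : (H × (κ → Multiplicative ℤ)) ⧸ A) = a := by
    intro a ha
    obtain ⟨⟨k, y⟩, hp, rfl⟩ := Finset.mem_image.1 ha
    exact ⟨k, y, (Finset.mem_sigma.1 hp).2, rfl⟩
  have hmemS : ∀ k, ∀ y ∈ Y k, ((ι ⟨k, y⟩ : H × (κ → Multiplicative ℤ)) : (H × (κ → Multiplicative ℤ)) ⧸ A) ∈ S := fun k y hy =>
    Finset.mem_image.2 ⟨⟨k, y⟩, Finset.mem_sigma.2 ⟨Finset.mem_univ _, hy⟩, rfl⟩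
  have hpow : ∀ k, ∀ y ∈ Y k, ((ι ⟨k, y⟩ : H × (κ → Multiplicative ℤ)) : (H × (κ → Multiplicative ℤ)) ⧸ A) ^ e k = 1 := by
    intro k y hy
    rw [← QuotientGroup.mk_pow, QuotientGroup.eq_one_iff]
    refine ⟨Multiplicative.ofAdd (Pi.single k 1), Prod.ext ?_ ?_⟩
    · simp only [centralHom_apply, ι, Prod.pow_fst, hz k y hy, toAdd_ofAdd]
      rw [Finset.prod_eq_single k (fun j _ hj => by simp [hj]) (by simp)]
      simp
    · funext j
      by_cases hj : j = k
      · subst j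
        simp [centralHom_apply, ι, ← ofAdd_nsmul]
      · simp [centralHom_apply, ι, hj]
  have hdic := closure_finite_and_card_le S ?_ ?_
  rotate_left
  · intro a ha b hb
    obtain ⟨k, y, hy, rfl⟩ := hSmem a ha
    obtain ⟨j, x, hx, rfl⟩ := hSmem b hb
    have h1 : y⁻¹ * x * y ∈ Y j := by simpa using hY j x hx y⁻¹
    have h2 : (ι ⟨k, y⟩)⁻¹ * ι ⟨j, x⟩ * ι ⟨k, y⟩ = ι ⟨j, y⁻¹ * x * y⟩ :=
      Prod.ext rfl (by simp only [ι, Prod.snd_mul, Prod.snd_inv]; rw [mul_right_comm]; simp)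
    have h3 := hmemS j _ h1
    rw [← h2] at h3
    exact h3
  · intro a ha
    obtain ⟨k, y, hy, rfl⟩ := hSmem a ha
    exact isOfFinOrder_iff_pow_eq_one.2 ⟨e k, he k, hpow k y hy⟩
  have hprod : ∏ a ∈ S, orderOf a ≤ s ^ ∑ k, (Y k).card := by
    calc ∏ a ∈ S, orderOf a ≤ ∏ a ∈ S, s := by
          refine Finset.prod_le_prod' fun a ha => ?_
          obtain ⟨k, y, hy, rfl⟩ := hSmem a ha
          exact (orderOf_le_of_pow_eq_one (he k) (hpow k y hy)).trans (hs k)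
      _ = s ^ S.card := Finset.prod_const _
      _ ≤ s ^ ∑ k, (Y k).card := by
          rcases Nat.eq_zero_or_pos s with rfl | hs0
          · have : IsEmpty κ := ⟨fun k => by have := hs k; have := he k; omega⟩
            have hS0 : S = ∅ := Finset.eq_empty_of_forall_notMem fun a ha => by
              obtain ⟨k, -⟩ := hSmem a ha
              exact this.elim k
            simp [hS0]
          · exact Nat.pow_le_pow_right hs0 (Finset.card_image_le.trans (Finset.card_sigma _ _).le)
  -- The second factor is abelian and `H` is perfect, so `⁅B, B⁆` is all of `H × 1`.
  let B : Subgroup (H × (κ → Multiplicative ℤ)) := closure (ι '' T)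
  have hB₁ : ⁅B, B⁆.map (MonoidHom.fst H (κ → Multiplicative ℤ)) = ⊤ := by
    have : B.map (MonoidHom.fst H (κ → Multiplicative ℤ)) = ⊤ := by
      rw [MonoidHom.map_closure, ← hgen]
      congr 1
      ext y
      simp [ι, T]
    rw [map_commutator, this]
    exact hH
  have hB₂ : ⁅B, B⁆ ≤ (MonoidHom.snd H (κ → Multiplicative ℤ)).ker := by
    rw [commutator_le]
    intro a _ b _
    rw [MonoidHom.mem_ker, map_commutatorElement, commutatorElement_eq_one_iff_mul_comm, mul_comm]
  have hB : ∀ h : H, ((h, 1) : H × (κ → Multiplicative ℤ)) ∈ B := by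
    intro h
    have hh : h ∈ ⁅B, B⁆.map (MonoidHom.fst H (κ → Multiplicative ℤ)) := hB₁ ▸ mem_top h
    obtain ⟨b, hb, rfl⟩ := hh
    have : b = (b.1, 1) := Prod.ext rfl (hB₂ hb)
    have h' := commutator_le_self B hb
    rw [this] at h'
    exact h'
  have hBmap : B.map (QuotientGroup.mk' A) ≤ closure (S : Set ((H × (κ → Multiplicative ℤ)) ⧸ A)) := by
    rw [MonoidHom.map_closure]
    refine Subgroup.closure_mono ?_
    rintro _ ⟨_, ⟨p, hp, rfl⟩, rfl⟩
    exact Finset.mem_image.2 ⟨p, hp, rfl⟩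
  let φ : H → closure (S : Set ((H × (κ → Multiplicative ℤ)) ⧸ A)) := fun h =>
    ⟨QuotientGroup.mk' A (h, 1), hBmap (mem_map_of_mem _ (hB h))⟩
  have hφ : Function.Injective φ := by
    intro x y hxy
    have h1 : (((x, 1) : H × (κ → Multiplicative ℤ)) : (H × (κ → Multiplicative ℤ)) ⧸ A) = (((y, 1) : H × (κ → Multiplicative ℤ)) : (H × (κ → Multiplicative ℤ)) ⧸ A) := congrArg Subtype.val hxy
    rw [QuotientGroup.eq] at h1
    obtain ⟨f, hf⟩ := h1
    have hf0 : f = 1 := by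
      funext k
      have h2 : (e k : ℤ) * f.toAdd k = 0 := by
        have := congrArg Multiplicative.toAdd (congrFun (congrArg Prod.snd hf) k)
        simpa only [centralHom_apply, toAdd_ofAdd, Prod.snd_mul, Prod.snd_inv, inv_one, mul_one,
          Pi.one_apply, toAdd_one] using this
      exact (mul_eq_zero.1 h2).resolve_left (by have := he k; omega)
    have h4 := congrArg Prod.fst hf
    subst hf0
    rw [map_one] at h4
    exact inv_mul_eq_one.1 h4.symm
  have := hdic.1
  exact ⟨Finite.of_injective φ hφ, (Nat.card_le_card_of_injective φ hφ).trans (hdic.2.trans hprod)⟩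

end Perfect

/-! ### The bound for finite perfect groups. -/

section PerfectBound

variable {H : Type v} [Group H]

/-- The maximal elements among the proper normal subgroups. -/
def IsMaximalNormal (M : Subgroup H) : Prop :=
  Maximal (fun N : Subgroup H => N.Normal ∧ N ≠ ⊤) M

/-- `H = ⁅A ⊔ M, B ⊔ M⁆`, and `⁅A, B⁆ ≤ A ⊓ B`. -/
theorem inf_sup_eq_top_of_perfect (hH : commutator H = ⊤) {A B M : Subgroup H} [A.Normal]
    [B.Normal] [M.Normal] (hA : A ⊔ M = ⊤) (hB : B ⊔ M = ⊤) : (A ⊓ B) ⊔ M = ⊤ := by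
  have key : ⁅A ⊔ M, B ⊔ M⁆ ≤ (A ⊓ B) ⊔ M := by
    refine commutator_sup_le_left ?_ ((commutator_le_left _ _).trans le_sup_right)
    rw [commutator_comm]
    refine commutator_sup_le_left ?_ ((commutator_le_left _ _).trans le_sup_right)
    rw [commutator_comm]
    exact (commutator_le_inf _ _).trans le_sup_left
  rw [hA, hB] at key
  exact top_le_iff.1 (hH ▸ key)

theorem iInf_sup_eq_top_of_perfect (hH : commutator H = ⊤) {κ : Type*} (s : Finset κ)
    (f : κ → Subgroup H) (hf : ∀ k ∈ s, (f k).Normal) {M : Subgroup H} [M.Normal]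
    (h : ∀ k ∈ s, f k ⊔ M = ⊤) : (s.inf f).Normal ∧ s.inf f ⊔ M = ⊤ := by
  classical
  induction s using Finset.induction_on with
  | empty => exact ⟨by rw [Finset.inf_empty]; infer_instance, by simp⟩
  | insert k s _ ih =>
    obtain ⟨h₁, h₂⟩ := ih (fun j hj => hf j (Finset.mem_insert_of_mem hj))
      (fun j hj => h j (Finset.mem_insert_of_mem hj))
    have := hf k (Finset.mem_insert_self _ _)
    rw [Finset.inf_insert]
    exact ⟨inferInstance, inf_sup_eq_top_of_perfect hH (h k (Finset.mem_insert_self _ _)) h₂⟩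

/-- Take a power `y ∉ M` of least order. If that order were `p ^ k * q` with coprime nontrivial
factors, `y ^ p ^ k` and `y ^ q` would lie in `M`, hence so would `y`. -/
theorem exists_pow_notMem_orderOf_eq_prime_pow {M : Subgroup H} [M.Normal] {x : H}
    (hx : IsOfFinOrder x) (hxM : x ∉ M) :
    ∃ j : ℕ, x ^ j ∉ M ∧ ∃ p k : ℕ, p.Prime ∧ orderOf (x ^ j) = p ^ k := by
  classical
  have hex : ∃ n, ∃ j : ℕ, x ^ j ∉ M ∧ orderOf (x ^ j) = n := ⟨_, 1, by simpa using hxM, rfl⟩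
  obtain ⟨j, hj, hn⟩ := Nat.find_spec hex
  have hmin : ∀ k : ℕ, orderOf (x ^ (j * k)) < orderOf (x ^ j) → x ^ (j * k) ∈ M := by
    intro k hk
    by_contra h
    exact Nat.find_min hex (hn ▸ hk) ⟨_, h, rfl⟩
  set y := x ^ j with hy
  have hyf : IsOfFinOrder y := hx.pow
  have hpos := hyf.orderOf_pos
  have hy1 : orderOf y ≠ 1 := fun h => hj (by rw [orderOf_eq_one_iff.1 h]; exact M.one_mem)
  have hp : (orderOf y).minFac.Prime := Nat.minFac_prime hy1
  set p := (orderOf y).minFac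
  obtain ⟨k, q, hq, hkq⟩ := Nat.exists_eq_pow_mul_and_not_dvd hpos.ne' p hp.ne_one
  refine ⟨j, hj, p, k, hp, ?_⟩
  by_contra hne
  have hk0 : k ≠ 0 := by
    rintro rfl
    rw [pow_zero, one_mul] at hkq
    exact hq (hkq ▸ Nat.minFac_dvd (orderOf y))
  have hq1 : q ≠ 1 := by rintro rfl; exact hne (by rw [← hy, hkq, mul_one])
  have hq0 : 0 < q := Nat.pos_of_ne_zero (by rintro rfl; simp at hq)
  have hpk : 1 < p ^ k := Nat.one_lt_pow hk0 hp.one_lt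
  have h₁ : y ^ (p ^ k) ∈ M := by
    rw [hy, ← pow_mul]
    refine hmin _ ?_
    rw [pow_mul, ← hy, orderOf_pow_of_dvd (by omega) (hkq ▸ dvd_mul_right _ _)]
    exact Nat.div_lt_self hpos hpk
  have h₂ : y ^ q ∈ M := by
    rw [hy, ← pow_mul]
    refine hmin _ ?_
    rw [pow_mul, ← hy, orderOf_pow_of_dvd (by omega) (hkq ▸ dvd_mul_left _ _)]
    exact Nat.div_lt_self hpos (by omega)
  rw [← QuotientGroup.eq_one_iff, QuotientGroup.mk_pow] at h₁ h₂
  have hcop : Nat.Coprime (p ^ k) q := ((Nat.Prime.coprime_iff_not_dvd hp).2 hq).pow_left k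
  have := Nat.dvd_gcd (orderOf_dvd_of_pow_eq_one h₁) (orderOf_dvd_of_pow_eq_one h₂)
  rw [hcop.gcd_eq_one, Nat.dvd_one, orderOf_eq_one_iff, QuotientGroup.eq_one_iff] at this
  exact hj this

/-- Conjugation by `y` has prime power order, so this order is the length of a single cycle on `W \
{1}`, not just a least common multiple of cycle lengths. -/
theorem orderOf_conj_le {W : Set H} (hW : W.Finite) (hgen : closure W = ⊤)
    (hconj : ∀ x ∈ W, ∀ g : H, g * x * g⁻¹ ∈ W) (hne : (W \ {1}).Nonempty) {y : H} {p k : ℕ}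
    (hp : p.Prime) (hy : orderOf y = p ^ k) : orderOf (MulAut.conj y) ≤ (W \ {1}).ncard := by
  have hfin : (W \ {1}).Finite := hW.subset Set.sdiff_subset
  obtain ⟨i, -, hi⟩ := (Nat.dvd_prime_pow hp).1 (hy ▸ orderOf_map_dvd MulAut.conj y)
  rcases i with _ | i
  · rw [hi, pow_zero]
    exact (Set.ncard_pos hfin).2 hne
  have hne1 : (MulAut.conj y) ^ p ^ i ≠ 1 := by
    intro h
    have := hi ▸ Nat.le_of_dvd (pow_pos hp.pos _) (orderOf_dvd_of_pow_eq_one h)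
    exact absurd this (Nat.pow_lt_pow_right hp.one_lt (Nat.lt_succ_self i)).not_ge
  obtain ⟨w, hw, hwne⟩ : ∃ w ∈ W, ((MulAut.conj y) ^ p ^ i) w ≠ w := by
    by_contra! h
    refine hne1 (MulEquiv.toMonoidHom_injective ?_)
    refine MonoidHom.eq_of_eqOn_dense hgen fun w hw => h w hw
  have hiter : ∀ n x, (MulAut.conj y)^[n] x = ((MulAut.conj y) ^ n) x := by
    intro n x
    induction n with
    | zero => rfl
    | succ n ih => rw [Function.iterate_succ_apply', ih, pow_succ']; rfl
  have hper : Function.minimalPeriod (MulAut.conj y) w = p ^ (i + 1) := by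
    have := Fact.mk hp
    refine Function.minimalPeriod_eq_prime_pow ?_ ?_
    · intro h
      exact hwne ((hiter _ _).symm.trans h)
    · refine (hiter _ _).trans ?_
      rw [← hi, pow_orderOf_eq_one]
      rfl
  rw [hi, ← hper]
  have hinj := Function.iterate_injOn_Iio_minimalPeriod (f := MulAut.conj y) (x := w)
  have hmap : ∀ n ∈ Set.Iio (Function.minimalPeriod (MulAut.conj y) w),
      (fun n => (MulAut.conj y)^[n] w) n ∈ W \ {1} := by
    intro n _
    refine ⟨?_, fun h => hwne ?_⟩
    · simp only [hiter, ← map_pow, MulAut.conj_apply]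
      exact hconj w hw _
    · simp only [Set.mem_singleton_iff, hiter, ← map_pow, MulAut.conj_apply] at h ⊢
      have : w = 1 := by simpa using h
      rw [this]; simp
  have := Set.ncard_le_ncard_of_injOn _ hmap hinj hfin
  simpa [Set.ncard_eq_toFinset_card'] using this

/-- A finite perfect group is bounded in terms of the number of nontrivial elements of a
conjugation-invariant generating set `W`, if `W` meets each normal subgroup `K` in all residue
classes that `W` meets modulo a normal supplement of `K`. -/
theorem card_le_of_perfect [Finite H] (hH : commutator H = ⊤) {W : Set H} (hgen : closure W = ⊤)
    (hconj : ∀ x ∈ W, ∀ g : H, g * x * g⁻¹ ∈ W)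
    (hlift : ∀ K M : Subgroup H, K.Normal → M.Normal → K ⊔ M = ⊤ →
      ∀ v ∈ W, ∃ v' ∈ W, v' ∈ K ∧ v'⁻¹ * v ∈ M) :
    Nat.card H ≤ (W \ {1}).ncard ^ (W \ {1}).ncard := by
  classical
  let κ := {M : Subgroup H // IsMaximalNormal M}
  have : Fintype κ := Fintype.ofFinite κ
  have hn : ∀ M : κ, M.1.Normal := fun M => M.2.1.1
  -- The intersection of the other maximal normal subgroups supplements `M`, so `hlift` moves an
  -- element of `W` outside `M` into it.
  have hx : ∀ M : κ, ∃ x ∈ W, x ∉ M.1 ∧ ∀ M' : κ, M' ≠ M → x ∈ M'.1 := by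
    intro M
    have hsup := iInf_sup_eq_top_of_perfect (M := M.1) hH (Finset.univ.erase M) (fun M : κ => M.1)
      (fun M _ => hn M) ?_
    · obtain ⟨v, hv, hvM⟩ : ∃ v ∈ W, v ∉ M.1 := by
        by_contra! h
        exact M.2.1.2 (top_le_iff.1 (hgen ▸ (closure_le _).2 h))
      obtain ⟨v', hv', hv'K, hv'M⟩ := hlift _ _ hsup.1 (hn M) hsup.2 v hv
      refine ⟨v', hv', fun h => hvM (by simpa using M.1.mul_mem h hv'M), fun M' hM' => ?_⟩
      exact (Finset.inf_le (f := fun M : κ => M.1)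
        (Finset.mem_erase.2 ⟨hM', Finset.mem_univ _⟩) : _ ≤ M'.1) hv'K
    · intro M' hM'
      by_contra hne
      have h₁ := M'.2.eq_of_le (y := M'.1 ⊔ M.1) ⟨inferInstance, hne⟩ le_sup_left
      have h₂ := M.2.eq_of_le (y := M'.1 ⊔ M.1) ⟨inferInstance, hne⟩ le_sup_right
      exact (Finset.mem_erase.1 hM').1 (Subtype.ext (h₁.trans h₂.symm))
  choose x hxW hxM hxM' using hx
  have hj := fun M : κ => exists_pow_notMem_orderOf_eq_prime_pow (isOfFinOrder_of_finite (x M))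
    (hxM M)
  choose j hjM p k hp hord using hj
  let X : κ → Finset H := fun M => (Set.range fun g : H => g * x M * g⁻¹).toFinite.toFinset
  have hXmem : ∀ M a, a ∈ X M ↔ ∃ g : H, g * x M * g⁻¹ = a := by simp [X]
  let Y : κ → Finset H := fun M => (X M).image (· ^ j M)
  have hYmem : ∀ M a, a ∈ Y M ↔ ∃ g : H, g * x M ^ j M * g⁻¹ = a := by
    simp [Y, hXmem, conj_pow]
  have hYconj : ∀ M, ∀ y ∈ Y M, ∀ g : H, g * y * g⁻¹ ∈ Y M := by
    intro M y hy g
    obtain ⟨h, rfl⟩ := (hYmem M y).1 hy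
    exact (hYmem _ _).2 ⟨g * h, by group⟩
  -- If proper, this normal subgroup would lie in some maximal `M`, but it contains `x M ^ j M ∉ M`.
  have hYgen : closure (⋃ M, (Y M : Set H)) = ⊤ := by
    by_contra hne
    have hnor : (closure (⋃ M, (Y M : Set H))).Normal := by
      refine normal_closure_of_conj fun a ha g => ?_
      obtain ⟨M, ha⟩ := Set.mem_iUnion.1 ha
      exact Set.mem_iUnion.2 ⟨M, hYconj M a ha g⟩
    obtain ⟨M, hle, hM⟩ := (Set.toFinite {N : Subgroup H | N.Normal ∧ N ≠ ⊤}).exists_le_maximal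
      (show closure (⋃ M, (Y M : Set H)) ∈ {N : Subgroup H | N.Normal ∧ N ≠ ⊤} from ⟨hnor, hne⟩)
    refine hjM ⟨M, hM⟩ (hle (subset_closure (Set.mem_iUnion.2 ⟨⟨M, hM⟩, ?_⟩)))
    exact (hYmem _ _).2 ⟨1, by simp⟩
  have hxne : ∀ M, x M ∈ W \ {1} := fun M =>
    ⟨hxW M, fun h => hxM M (by rw [h]; exact M.1.one_mem)⟩
  have hz : ∀ M, (x M ^ j M) ^ orderOf (MulAut.conj (x M ^ j M)) ∈ center H := by
    intro M
    rw [mem_center_iff]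
    intro g
    have h₁ := pow_orderOf_eq_one (MulAut.conj (x M ^ j M))
    rw [← map_pow] at h₁
    have h₂ := DFunLike.congr_fun h₁ g
    rw [MulAut.conj_apply, MulAut.one_apply, mul_inv_eq_iff_eq_mul] at h₂
    exact h₂.symm
  -- Conjugates of `x M` avoid `M` and lie in all other maximal normal subgroups, so the classes are
  -- disjoint.
  have hsum : ∑ M, (Y M).card ≤ (W \ {1}).ncard := by
    calc ∑ M, (Y M).card ≤ ∑ M, (X M).card := Finset.sum_le_sum fun M _ => Finset.card_image_le
      _ = (Finset.univ.biUnion X).card := by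
          refine (Finset.card_biUnion fun M _ M' _ hne => ?_).symm
          rw [Function.onFun, Finset.disjoint_left]
          intro a ha ha'
          obtain ⟨g, rfl⟩ := (hXmem _ _).1 ha
          obtain ⟨g', hg'⟩ := (hXmem _ _).1 ha'
          have h₁ : g' * x M' * g'⁻¹ ∈ M.1 := (hn M).conj_mem _ (hxM' M' M hne) g'
          rw [hg'] at h₁
          exact hxM M (by simpa [mul_assoc] using (hn M).conj_mem _ h₁ g⁻¹)
      _ = ((Finset.univ.biUnion X : Finset H) : Set H).ncard := (Set.ncard_coe_finset _).symm
      _ ≤ (W \ {1}).ncard := by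
          refine Set.ncard_le_ncard ?_ (Set.toFinite _)
          intro a ha
          obtain ⟨M, -, ha⟩ := Finset.mem_biUnion.1 ha
          obtain ⟨g, rfl⟩ := (hXmem _ _).1 ha
          refine ⟨hconj _ (hxW M) g, fun h => (hxne M).2 ?_⟩
          simpa using h
  have key := finite_and_card_le_of_perfect hH Y hYconj hYgen
    (fun M => orderOf (MulAut.conj (x M ^ j M))) (fun M => orderOf_pos _) (fun M => ⟨_, hz M⟩)
    (s := (W \ {1}).ncard) ?_ ?_
  · refine key.2.trans ?_
    rcases Nat.eq_zero_or_pos (W \ {1}).ncard with h0 | h0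
    · rw [h0] at hsum ⊢
      rw [Nat.le_zero.1 hsum]
    · exact Nat.pow_le_pow_right h0 hsum
  · intro M y hy
    obtain ⟨g, rfl⟩ := (hYmem _ _).1 hy
    rw [conj_pow, mem_center_iff.1 (hz M) g, mul_inv_cancel_right]
  · exact fun M => orderOf_conj_le (Set.toFinite W) hgen hconj ⟨_, hxne M⟩ (hp M) (hord M)

end PerfectBound

/-! ### From words to trees, and values in subgroups. -/

theorem lift_eq_of_eqOn_indeterminates {X : Type u} {G : Type v} [Group G] {w : FreeGroup X}
    {g g' : X → G} (h : Set.EqOn g g' (indeterminates w)) :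
    FreeGroup.lift g w = FreeGroup.lift g' w := by
  let _ : DecidableEq X := Classical.decEq X
  rw [← FreeGroup.mk_toWord (x := w), FreeGroup.lift_mk, FreeGroup.lift_mk]
  congr 1
  refine List.map_congr_left fun x hx => ?_
  rw [h (show x.1 ∈ indeterminates w from ⟨x.2, hx⟩)]

/-- The values of an outer commutator word are the values of the tree that describes it. -/
theorem IsOuterCommutator.exists_commTree {X : Type u} {w : FreeGroup X}
    (hw : IsOuterCommutator w) : ∃ t : CommTree, t.erase = t ∧
      ∀ (G : Type v) [Group G], values w G = t.val (derivedSeries G) := by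
  induction hw with
  | indeterminate x =>
    refine ⟨.leaf 0, rfl, fun G _ => Set.eq_of_subset_of_subset (fun y _ => mem_top y) ?_⟩
    intro y _
    exact ⟨fun _ => y, by simp⟩
  | commutator a b _ _ hab iha ihb =>
    obtain ⟨l, hl, hl'⟩ := iha
    obtain ⟨r, hr, hr'⟩ := ihb
    refine ⟨.node l r, by simp [CommTree.erase, hl, hr], fun G _ => ?_⟩
    ext y
    constructor
    · rintro ⟨g, rfl⟩
      exact ⟨FreeGroup.lift g a, (hl' G).subset ⟨g, rfl⟩, FreeGroup.lift g b,
        (hr' G).subset ⟨g, rfl⟩, by simp⟩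
    · rintro ⟨_, hx, _, hz, rfl⟩
      rw [← hl'] at hx
      rw [← hr'] at hz
      obtain ⟨g, rfl⟩ := hx
      obtain ⟨g', rfl⟩ := hz
      classical
      -- Disjointness allows the two substitutions to be merged into one.
      let f : X → G := fun x => if x ∈ indeterminates a then g x else g' x
      have hf : FreeGroup.lift f a = FreeGroup.lift g a :=
        lift_eq_of_eqOn_indeterminates fun x hx => if_pos hx
      have hf' : FreeGroup.lift f b = FreeGroup.lift g' b :=
        lift_eq_of_eqOn_indeterminates fun x hx => if_neg fun h => Set.disjoint_left.1 hab h hx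
      exact ⟨f, by simp [hf, hf']⟩

namespace CommTree

/-- Replace each entry by its `K`-component. This supplies `hlift` in `card_le_of_perfect`. -/
theorem exists_val_mem_of_sup_eq_top {H : Type v} [Group H] (t : CommTree) (ht : t.erase = t)
    {K M : Subgroup H} [K.Normal] [M.Normal] (h : K ⊔ M = ⊤) {v : H}
    (hv : v ∈ t.val (derivedSeries H)) :
    ∃ v' ∈ t.val (derivedSeries H), v' ∈ K ∧ (v' : H ⧸ M) = v := by
  induction t generalizing v with
  | leaf n =>
    obtain rfl : 0 = n := by simpa [erase] using ht
    obtain ⟨k, hk, m, hm, rfl⟩ := mem_sup_of_normal_right.1 (h ▸ mem_top v)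
    exact ⟨k, mem_top k, hk, by simpa [QuotientGroup.eq] using hm⟩
  | node l r hl hr =>
    simp only [erase, node.injEq] at ht
    obtain ⟨a, ha, b, hb, rfl⟩ := hv
    obtain ⟨a', ha', haK, haM⟩ := hl ht.1 ha
    obtain ⟨b', hb', hbK, hbM⟩ := hr ht.2 hb
    refine ⟨_, ⟨a', ha', b', hb', rfl⟩, ?_, by simp [haM, hbM]⟩
    exact mul_mem (mul_mem (mul_mem (inv_mem haK) (inv_mem hbK)) haK) hbK

theorem coe_mem_val {G : Type v} [Group G] (t : CommTree) (ht : t.erase = t) {P : Subgroup G}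
    {x : P} (hx : x ∈ t.val (derivedSeries P)) : (x : G) ∈ t.val (derivedSeries G) := by
  induction t generalizing x with
  | leaf n =>
    obtain rfl : 0 = n := by simpa [erase] using ht
    exact mem_top _
  | node l r hl hr =>
    simp only [erase, node.injEq] at ht
    obtain ⟨a, ha, b, hb, rfl⟩ := hx
    exact ⟨a, hl ht.1 ha, b, hr ht.2 hb, by simp⟩

end CommTree

/-- A perfect group generated by a finite conjugation-invariant set is finite. -/
theorem finite_of_perfect {H : Type v} [Group H] (hH : commutator H = ⊤) {W : Set H}
    (hW : W.Finite) (hgen : closure W = ⊤) (hconj : ∀ x ∈ W, ∀ g : H, g * x * g⁻¹ ∈ W) :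
    Finite H := by
  classical
  have := hW.to_subtype
  have : Fintype W := Fintype.ofFinite W
  -- Conjugation by `w` permutes the finite set `W`, so some power of `w` centralizes `W` and thus
  -- `H`.
  have hpow : ∀ w : W, ∃ n, 0 < n ∧ (w : H) ^ n ∈ center H := by
    intro w
    let σ : Equiv.Perm W := Equiv.Perm.subtypePerm (p := (· ∈ W)) (MulAut.conj (w : H)).toEquiv fun x => by
      refine ⟨fun h => ?_, fun h => hconj x h w⟩
      simpa [mul_assoc] using hconj _ h (w : H)⁻¹
    have hσ : ∀ n (x : W), ((σ ^ n) x : H) = (w : H) ^ n * x * ((w : H) ^ n)⁻¹ := by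
      intro n x
      induction n with
      | zero => simp
      | succ n ih =>
        rw [pow_succ', Equiv.Perm.mul_apply]
        change (w : H) * ((σ ^ n) x : H) * (w : H)⁻¹ = _
        rw [ih]
        group
    refine ⟨orderOf σ, orderOf_pos σ, ?_⟩
    rw [← centralizer_univ, ← coe_top, ← hgen, centralizer_closure, mem_centralizer_iff]
    intro x hx
    have := hσ (orderOf σ) ⟨x, hx⟩
    rw [pow_orderOf_eq_one] at this
    exact eq_mul_inv_iff_mul_eq.1 this
  choose e he hz using hpow
  let Y : W → Finset H := fun w =>
    (hW.subset (Set.range_subset_iff.2 fun g => hconj w w.2 g)).toFinset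
  have hY : ∀ w y, y ∈ Y w ↔ ∃ g : H, g * w * g⁻¹ = y := by simp [Y]
  refine (finite_and_card_le_of_perfect hH Y ?_ ?_ e he (fun w => ⟨_, hz w⟩) ?_
    (fun w => Finset.single_le_sum (f := e) (fun _ _ => Nat.zero_le _) (Finset.mem_univ w))).1
  · intro w y hy g
    obtain ⟨h, rfl⟩ := (hY _ _).1 hy
    exact (hY _ _).2 ⟨g * h, by group⟩
  · refine top_le_iff.1 (hgen ▸ Subgroup.closure_mono fun w hw => ?_)
    exact Set.mem_iUnion.2 ⟨⟨w, hw⟩, (hY _ _).2 ⟨1, by simp⟩⟩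
  · intro w y hy
    obtain ⟨g, rfl⟩ := (hY _ _).1 hy
    rw [conj_pow, mem_center_iff.1 (hz w) g, mul_inv_cancel_right]

/-! ### The soluble and insoluble bounds. -/

namespace CommTree

variable {G : Type v} [Group G] (t : CommTree)

local notation "D" => derivedSeries G

theorem card_sub_le_of_isSolvable [Group.IsSolvable G] (ht : t.erase = t)
    (hW : (t.val D).Finite) :
    Finite (t.sub D) ∧ Nat.card (t.sub D) ≤ 2 ^ ((t.val D).ncard - 1) := by
  obtain ⟨d, hd⟩ := Group.IsSolvable.solvable (G := G)
  have h := t.boundedOver_sub ht hW d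
  rw [hd, bot_sup_eq] at h
  have h₀ := h.ne_zero
  have h₁ := h.le_two_pow
  rw [relIndex_bot_left] at h₀ h₁
  refine ⟨Nat.finite_of_card_ne_zero h₀, h₁.trans (Nat.pow_le_pow_right two_pos ?_)⟩
  rw [← Set.ncard_sdiff_singleton_of_mem (t.one_mem_val D)]
  refine Set.ncard_le_ncard ?_ (hW.subset Set.sdiff_subset)
  rintro x ⟨hx, -, hx1⟩
  exact ⟨hx, by simpa using hx1⟩

/-- Strict descent would make the indices in `t.sub D` grow without bound, against the uniform bound
`2 ^ (t.val D).ncard`. -/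
theorem exists_derivedSeries_stable (ht : t.erase = t) (hW : (t.val D).Finite) :
    ∃ k, t.height ≤ k ∧ D k ≤ D (k + 1) := by
  by_contra! h
  have hle : ∀ n, D (t.height + n) ≤ t.sub D := fun n =>
    (derivedSeries_antitone G (Nat.le_add_right _ _)).trans (t.derivedSeries_height_le ht)
  have hb : ∀ n, BoundedOver (t.val D) (D (t.height + n)) (t.sub D) := fun n => by
    have := t.boundedOver_sub ht hW (t.height + n)
    rwa [sup_eq_right.2 (hle n)] at this
  have hgrow : ∀ n, n < (D (t.height + n)).relIndex (t.sub D) := by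
    intro n
    induction n with
    | zero => exact Nat.pos_of_ne_zero (hb 0).ne_zero
    | succ n ih =>
      have hmul := relIndex_mul_relIndex (D (t.height + (n + 1))) (D (t.height + n)) (t.sub D)
        (derivedSeries_antitone G (by omega)) (hle n)
      have h₀ := (hb (n + 1)).ne_zero
      have h₁ : (D (t.height + (n + 1))).relIndex (D (t.height + n)) ≠ 1 := fun h₁ =>
        h (t.height + n) (Nat.le_add_right _ _) (relIndex_eq_one.1 h₁)
      rw [← hmul] at h₀ ⊢
      have h₂ := left_ne_zero_of_mul h₀
      have : 2 ≤ (D (t.height + (n + 1))).relIndex (D (t.height + n)) := by omega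
      nlinarith
  have h₁ := hgrow (2 ^ (t.val D).ncard)
  have h₂ := (hb (2 ^ (t.val D).ncard)).le_two_pow
  have h₃ := Nat.pow_le_pow_right two_pos
    (Set.ncard_le_ncard (t := t.val D) (Set.inter_subset_left (t :=
      ((t.sub D : Set G) \ D (t.height + 2 ^ (t.val D).ncard)))) hW)
  omega

theorem card_sub_le_of_not_isSolvable (hG : ¬ Group.IsSolvable G) (ht : t.erase = t)
    (hW : (t.val D).Finite) :
    Finite (t.sub D) ∧
      Nat.card (t.sub D) ≤ ((t.val D).ncard - 1) ^ ((t.val D).ncard - 1) := by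
  obtain ⟨k, hk, hkle⟩ := t.exists_derivedSeries_stable ht hW
  set P := D k with hP
  have hPP : commutator P = ⊤ := by
    refine map_injective P.subtype_injective ?_
    rw [map_subtype_commutator, ← MonoidHom.range_eq_map, P.range_subtype]
    exact le_antisymm (commutator_le_self P) hkle
  have hPsub : P ≤ t.sub D :=
    (derivedSeries_antitone G hk).trans (t.derivedSeries_height_le ht)
  have hPbot : P ≠ ⊥ := fun h => hG ⟨k, h⟩
  have hb := t.boundedOver_sub ht hW k
  rw [← hP, sup_eq_right.2 hPsub] at hb
  have hperf : ∀ n, derivedSeries P n = ⊤ := by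
    intro n
    induction n with
    | zero => rfl
    | succ n ih => rw [derivedSeries_succ, ih]; exact hPP
  set V := t.val (derivedSeries P) with hV
  have hVW : ∀ x ∈ V, (x : G) ∈ t.val D := fun x hx => t.coe_mem_val ht hx
  have hVfin : V.Finite := Set.Finite.of_injOn hVW Subtype.val_injective.injOn hW
  have hVgen : closure V = ⊤ := by
    rw [hV, ← sub_eq_closure, ← top_le_iff, ← hperf t.height]
    exact t.derivedSeries_height_le ht
  have hVconj : ∀ x ∈ V, ∀ g : P, g * x * g⁻¹ ∈ V := fun x hx g => t.val_conj _ hx g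
  have hPfin : Finite P := finite_of_perfect hPP hVfin hVgen hVconj
  have hcard := card_le_of_perfect hPP hVgen hVconj ?_
  swap
  · intro K M _ _ hKM v hv
    obtain ⟨v', hv', hK, hM⟩ := t.exists_val_mem_of_sup_eq_top ht hKM hv
    exact ⟨v', hv', hK, QuotientGroup.eq.1 hM⟩
  set s := (V \ {1}).ncard with hs
  -- If `s ≤ 1` then `s ^ s = 1` (also for `s = 0`), so `P` would be trivial and `G` soluble.
  have hs2 : 2 ≤ s := by
    by_contra! hlt
    have h1 : s ^ s ≤ 1 := by interval_cases s <;> norm_num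
    exact hPbot (Subgroup.card_le_one_iff_eq_bot P |>.1 (hcard.trans h1))
  have hcount : s + (t.val D ∩ (t.sub D \ P)).ncard ≤ (t.val D).ncard - 1 := by
    rw [← Set.ncard_sdiff_singleton_of_mem (t.one_mem_val D), hs,
      ← Set.ncard_image_of_injective (V \ {1}) P.subtype_injective,
      ← Set.ncard_union_eq ?_ ((hVfin.subset Set.sdiff_subset).image _) (hW.inter_of_left _)]
    · refine Set.ncard_le_ncard ?_ (hW.subset Set.sdiff_subset)
      rintro x (⟨x, ⟨hx, hx1⟩, rfl⟩ | ⟨hx, -, hxP⟩)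
      · exact ⟨hVW x hx, fun h => hx1 (Subtype.ext h)⟩
      · exact ⟨hx, fun h => hxP (by rw [Set.mem_singleton_iff.1 h]; exact P.one_mem)⟩
    · rw [Set.disjoint_left]
      rintro _ ⟨x, -, rfl⟩ ⟨-, -, hxP⟩
      exact hxP x.2
  have hmul : Nat.card P * P.relIndex (t.sub D) = Nat.card (t.sub D) := by
    have := relIndex_mul_relIndex ⊥ P (t.sub D) bot_le hPsub
    rwa [relIndex_bot_left, relIndex_bot_left] at this
  have hpos : Nat.card (t.sub D) ≠ 0 := by
    rw [← hmul]
    exact mul_ne_zero Nat.card_pos.ne' hb.ne_zero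
  refine ⟨Nat.finite_of_card_ne_zero hpos, ?_⟩
  set m := (t.val D).ncard - 1
  calc Nat.card (t.sub D) = Nat.card P * P.relIndex (t.sub D) := hmul.symm
    _ ≤ s ^ s * 2 ^ (t.val D ∩ (t.sub D \ P)).ncard := Nat.mul_le_mul hcard hb.le_two_pow
    -- Both bases are at most `m`, since `2 ≤ s ≤ m`.
    _ ≤ m ^ s * m ^ (t.val D ∩ (t.sub D \ P)).ncard :=
        Nat.mul_le_mul (Nat.pow_le_pow_left (by omega) _) (Nat.pow_le_pow_left (by omega) _)
    _ = m ^ (s + (t.val D ∩ (t.sub D \ P)).ncard) := (pow_add _ _ _).symm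
    _ ≤ m ^ m := Nat.pow_le_pow_right (by omega) hcount

end CommTree

/-- The bounds for the order of the verbal subgroup of an outer commutator word. -/
theorem IsOuterCommutator.card_verbalSubgroup_le {X : Type u} {w : FreeGroup X}
    (hw : IsOuterCommutator w) (G : Type v) [Group G] {m : ℕ}
    (hm : (values w G).encard = (m : ℕ∞)) :
    (Group.IsSolvable G →
      Finite (verbalSubgroup w G) ∧ Nat.card (verbalSubgroup w G) ≤ 2 ^ (m - 1)) ∧
    (¬ Group.IsSolvable G →
      Finite (verbalSubgroup w G) ∧ Nat.card (verbalSubgroup w G) ≤ (m - 1) ^ (m - 1)) := by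
  obtain ⟨t, ht, hval⟩ := hw.exists_commTree.{u, v}
  have hfin : (values w G).Finite := Set.finite_of_encard_eq_coe hm
  obtain rfl : (values w G).ncard = m := by rw [Set.ncard, hm, ENat.toNat_natCast]
  rw [verbalSubgroup, hval G, ← CommTree.sub_eq_closure]
  rw [hval G] at hfin
  exact ⟨fun _ => t.card_sub_le_of_isSolvable ht hfin,
    fun hG => t.card_sub_le_of_not_isSolvable hG ht hfin⟩

end GroupWord

/-- The first part gives the explicit bounds (finiteness of the verbal subgroup is part of each
bound; note that `1 ≤ m` always holds, as `1` is a value of every word). The second part is the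
uniform conciseness of outer commutator words: one function of `m` bounds the order of the verbal
subgroup for all outer commutator words and all groups. -/
theorem theoremA :
    (∀ (X : Type u) (w : FreeGroup X) (G : Type v) [Group G] (m : ℕ),
      GroupWord.IsOuterCommutator w → (GroupWord.values w G).encard = (m : ℕ∞) →
        (Group.IsSolvable G →
          Finite (GroupWord.verbalSubgroup w G) ∧
            Nat.card (GroupWord.verbalSubgroup w G) ≤ 2 ^ (m - 1)) ∧
        (¬ Group.IsSolvable G →
          Finite (GroupWord.verbalSubgroup w G) ∧
            Nat.card (GroupWord.verbalSubgroup w G) ≤ (m - 1) ^ (m - 1))) ∧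
    (∃ f : ℕ → ℕ, ∀ (X : Type u) (w : FreeGroup X) (G : Type v) [Group G] (m : ℕ),
      GroupWord.IsOuterCommutator w → (GroupWord.values w G).encard = (m : ℕ∞) →
        Finite (GroupWord.verbalSubgroup w G) ∧
          Nat.card (GroupWord.verbalSubgroup w G) ≤ f m) := by
  refine ⟨fun X w G _ m hw hm => hw.card_verbalSubgroup_le G hm,
    fun m => 2 ^ (m - 1) + (m - 1) ^ (m - 1), fun X w G _ m hw hm => ?_⟩
  obtain ⟨h₁, h₂⟩ := hw.card_verbalSubgroup_le G hm
  by_cases hG : Group.IsSolvable G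
  · exact ⟨(h₁ hG).1, (h₁ hG).2.trans (Nat.le_add_right _ _)⟩
  · exact ⟨(h₂ hG).1, (h₂ hG).2.trans (Nat.le_add_left _ _)⟩
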